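/- **Setting.** Let $V=[n]$, let $k$ be the number of types, and let $(k+1)^V$ be the set of vectors $\boldsymbol x$ that leave each $e\in V$ unassigned ($\boldsymbol x(e)=0$) or give it one type $\boldsymbol x(e)\in[k]$; write $X_i=\{e:\boldsymbol x(e)=i\}$ and $\operatorname{supp}(\boldsymbol x)=\bigcup_i X_i$. A function $f:(k+1)^V\to\mathbb R$ is $k$-submodular if $f(\boldsymbol x)+f(\boldsymbol y)\ge f(\boldsymbol x\sqcup\boldsymbol y)+f(\boldsymbol x\sqcap\boldsymbol y)$ for all $\boldsymbol x,\boldsymbol y$, where $\boldsymbol x\sqcap\boldsymbol y$ has the sets $X_i\cap Y_i$ and $\boldsymbol x\sqcup\boldsymbol y$ the sets $(X_i\cup Y_i)\setminus\bigcup_{j\ne i}(X_j\cup Y_j)$. It is monotone if assigning a type to an unassigned element never decreases $f$. Under the total size (TS) constraint with budget $B$ (the uniform matroid), the set of feasible actions is $D=\{\boldsymbol x:|\operatorname{supp}(\boldsymbol x)|\le B\}$. **Online problem.** At each time $t=1,\dots,T$ the learner plays $A_t\in D$ and observes only the reward $f_t(A_t)$. The random reward functions $f_1,\dots,f_T$ are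 $[0,1]$-valued on $D$, independent over time, and for each $\boldsymbol a\in D$ the rewards $f_t(\boldsymbol a)$ are identically distributed with mean $f(\boldsymbol a)$, where $f$ is monotone and $k$-submodular. With $\mathrm{OPT}\in\arg\max_{D}f$, the expected cumulative $1/2$-regret is $$\mathbb E[\mathcal R_T]=\tfrac12\,T f(\mathrm{OPT})-\mathbb E\Big[\sum_{t=1}^T f_t(A_t)\Big].$$ **Algorithms.** The greedy algorithm starts from $\boldsymbol s=\boldsymbol 0$ and, for as many rounds as the rank of the matroid (that is, $\min(n,B)$), queries the value of $\boldsymbol s$ with $e$ set to $i$ for every unassigned $e$ with $|\operatorname{supp}(\boldsymbol s)|+1\le B$ and every type $i$, and adds a pair $(e,i)$ with largest reported value (equivalently, largest reported marginal gain), ties being broken by any fixed rule. C-ETC with horizon $T$, parameter $\delta=B+1$ and query bound $N=nkB$ plays each action queried by the greedy algorithm $m=\left\lceil \delta^{2/3}T^{2/3}\log(T)^{1/3}/(2N^{2/3})\right\rceil$ times, reports the empirical mean of the observed rewards as the value, and plays the output of the greedy algorithm for the remaining time, stopping at time $T$ in any case (if $N=0$ nothing is queried). **Statement.** Whatever values are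 reported to it, the greedy algorithm makes at most $N=nkB$ queries. Moreover, there is an absolute constant $C>0$ such that for all $n,k,B$, all online problems as above and all $T$ with $$T\ge nk\max\Big\{1,\frac{3\sqrt2\,B}{2(B+1)}\Big\},$$ C-ETC with the greedy algorithm plays only feasible actions, its cumulative reward is integrable, and its expected cumulative $1/2$-regret satisfies $$\mathbb E[\mathcal R_T]\le C\,n^{1/3}k^{1/3}B\,T^{2/3}\log(T)^{1/3}.$$ -/

import Mathlib

open MeasureTheory ProbabilityTheory

namespace KSubBandit

/-! ### `k`-submodular functions -/

/-- `(k+1)^V` for `V = [n]`: every element `e` is unassigned (`none`, the value `0` of the usual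
notation) or has exactly one type `some i`. The `i`-th set of the tuple is `{e | x e = some i}`. -/
abbrev KVec (n k : ℕ) : Type := Fin n → Option (Fin k)

/-- `x ⊓ y = (X₁ ∩ Y₁, …, X_k ∩ Y_k)`. -/
def meet {n k : ℕ} (x y : KVec n k) : KVec n k :=
  fun e => if x e = y e then x e else none

/-- `x ⊔ y`, whose `i`-th set is `(X_i ∪ Y_i) \ ⋃_{j ≠ i} (X_j ∪ Y_j)`. -/
def join {n k : ℕ} (x y : KVec n k) : KVec n k :=
  fun e => if x e = none then y e else if y e = none ∨ x e = y e then x e else none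

theorem meet_eq_some_iff {n k : ℕ} (x y : KVec n k) (e : Fin n) (i : Fin k) :
    meet x y e = some i ↔ x e = some i ∧ y e = some i := by
  unfold meet
  split_ifs with h
  · rw [← h]; simp
  · constructor
    · intro h'; simp at h'
    · rintro ⟨h1, h2⟩; exact absurd (h1.trans h2.symm) h

theorem join_eq_some_iff {n k : ℕ} (x y : KVec n k) (e : Fin n) (i : Fin k) :
    join x y e = some i ↔
      (x e = some i ∨ y e = some i) ∧ ∀ j, j ≠ i → ¬ (x e = some j ∨ y e = some j) := by
  unfold join
  rcases hx : x e with _ | a <;> rcases hy : y e with _ | b <;> simp <;> grind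

/-- The support of `x`. -/
def supp {n k : ℕ} (x : KVec n k) : Finset (Fin n) :=
  Finset.univ.filter fun e => x e ≠ none

/-- The vector obtained from `x` by giving the element `e` the type `i`. -/
def assign {n k : ℕ} (x : KVec n k) (e : Fin n) (i : Fin k) : KVec n k :=
  Function.update x e (some i)

/-- The marginal gain `Δ_{e,i} f(x)` (used for unassigned `e` only). -/
def marginal {n k : ℕ} (f : KVec n k → ℝ) (x : KVec n k) (e : Fin n) (i : Fin k) : ℝ :=
  f (assign x e i) - f x

def IsKSubmodular {n k : ℕ} (f : KVec n k → ℝ) : Prop :=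
  ∀ x y : KVec n k, f (join x y) + f (meet x y) ≤ f x + f y

def IsKMonotone {n k : ℕ} (f : KVec n k → ℝ) : Prop :=
  ∀ (x : KVec n k) (e : Fin n) (i : Fin k), x e = none → 0 ≤ marginal f x e i

/-! ### The constraint -/

/-- The independent sets of the uniform matroid: the total size constraint with budget `B`. -/
def totalSize (n B : ℕ) : Finset (Finset (Fin n)) :=
  Finset.univ.filter fun S => S.card ≤ B

/-- The rank of a set system: the largest size of an independent set. -/
def rank {n : ℕ} (𝓕 : Finset (Finset (Fin n))) : ℕ :=
  𝓕.sup Finset.card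

theorem rank_totalSize (n B : ℕ) : rank (totalSize n B) = min n B := by
  apply le_antisymm
  · refine Finset.sup_le fun S hS => le_min ?_ ?_
    · simpa using Finset.card_le_univ S
    · simpa [totalSize] using hS
  · obtain ⟨S, -, hS⟩ := Finset.exists_subset_card_eq
      (s := (Finset.univ : Finset (Fin n))) (n := min n B) (by simp)
    rw [← hS]
    exact Finset.le_sup (f := Finset.card) (by simp [totalSize, hS])

/-- The feasible actions: the vectors whose support is independent. -/
def feasible {n : ℕ} (k : ℕ) (𝓕 : Finset (Finset (Fin n))) : Set (KVec n k) :=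
  {x | supp x ∈ 𝓕}

/-! ### Offline algorithms with a value oracle -/

/-- A (deterministic, adaptive) algorithm that queries values of actions and outputs an action. -/
inductive OracleAlg (A : Type) : Type
  | done (a : A) : OracleAlg A
  | query (a : A) (next : ℝ → OracleAlg A) : OracleAlg A

/-- Whatever the answers of the oracle are, the algorithm makes at most `N` queries. -/
def OracleAlg.QueriesAtMost {A : Type} : OracleAlg A → ℕ → Prop
  | .done _, _ => True
  | .query _ _, 0 => False
  | .query _ next, N + 1 => ∀ r : ℝ, (next r).QueriesAtMost N

/-- Query the values of the actions `act p` for `p` in the list, record the answers in `v`,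
and continue with the recorded answers. -/
def queryValues {A P : Type} [DecidableEq P] (act : P → A) :
    List P → (P → ℝ) → ((P → ℝ) → OracleAlg A) → OracleAlg A
  | [], v, cont => cont v
  | p :: l, v, cont => .query (act p) fun r => queryValues act l (Function.update v p r) cont

/-- A rule for breaking ties in the arg max: given the current solution, it picks a member of
any nonempty set of maximizing pairs. -/
def TieRule (n k : ℕ) : Type :=
  KVec n k → (S : Finset (Fin n × Fin k)) → S.Nonempty → {p : Fin n × Fin k // p ∈ S}

/-- The pairs `(e, i)` with `e ∈ E(s)`, that is, `e` unassigned and `supp s ∪ {e}` independent. -/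
def availablePairs {n k : ℕ} (𝓕 : Finset (Finset (Fin n))) (s : KVec n k) :
    Finset (Fin n × Fin k) :=
  Finset.univ.filter fun p => s p.1 = none ∧ insert p.1 (supp s) ∈ 𝓕

/-- The given number of rounds of the greedy algorithm, from the solution `s`. A round queries the
value of `s` with `e` set to `i`, for each available pair `(e, i)`, and adds a pair of largest
value; since the value of `s` itself is common to all pairs, this is a pair of largest marginal
gain. -/
noncomputable def greedyRounds {n k : ℕ} (𝓕 : Finset (Finset (Fin n))) (tie : TieRule n k) :
    ℕ → KVec n k → OracleAlg (KVec n k)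
  | 0, s => .done s
  | j + 1, s =>
    queryValues (fun p => assign s p.1 p.2) (availablePairs 𝓕 s).toList (fun _ => 0) fun v =>
      if h : ((availablePairs 𝓕 s).filter
          fun p => ∀ q ∈ availablePairs 𝓕 s, v q ≤ v p).Nonempty then
        greedyRounds 𝓕 tie j (assign s (tie s _ h).1.1 (tie s _ h).1.2)
      else .done s

/-- The greedy algorithm under the matroid constraint `𝓕`: as many rounds as the rank, from `0`. -/
noncomputable def matroidGreedy {n k : ℕ} (𝓕 : Finset (Finset (Fin n))) (tie : TieRule n k) :
    OracleAlg (KVec n k) :=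
  greedyRounds 𝓕 tie (rank 𝓕) fun _ => none

/-! ### Combinatorial explore-then-commit -/

/-- The number of times `m = ⌈δ^{2/3} T^{2/3} log(T)^{1/3} / (2 N^{2/3})⌉` each query is played. -/
noncomputable def cetcRepetitions (δ : ℝ) (N T : ℕ) : ℕ :=
  ⌈δ ^ (2 / 3 : ℝ) * (T : ℝ) ^ (2 / 3 : ℝ) * Real.log T ^ (1 / 3 : ℝ) /
    (2 * (N : ℝ) ^ (2 / 3 : ℝ))⌉₊

/-- The state of C-ETC: what remains of the offline algorithm, and the rewards observed so far
for its pending query. -/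
structure CETCState (A : Type) where
  alg : OracleAlg A
  samples : List ℝ

/-- Play the pending query (exploration) or the output of the offline algorithm (exploitation). -/
def CETCState.play {A : Type} (st : CETCState A) : A :=
  match st.alg with
  | .done a => a
  | .query a _ => a

/-- The update after the reward `r`: as soon as the pending query has been played `m` times, the
empirical mean is returned to the offline algorithm. -/
noncomputable def CETCState.step {A : Type} (m : ℕ) (st : CETCState A) (r : ℝ) : CETCState A :=
  match st.alg with
  | .done a => ⟨.done a, []⟩
  | .query a next =>
    if st.samples.length + 1 < m then ⟨.query a next, r :: st.samples⟩
    else ⟨next ((r :: st.samples).sum / (r :: st.samples).length), []⟩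

/-- The state before the play at time `t` (times `0, 1, …`). If `x t` is the reward function of
time `t`, the learner only observes `x t` at the action it plays. -/
noncomputable def cetcState {A : Type} (m : ℕ) (alg : OracleAlg A) (x : ℕ → A → ℝ) :
    ℕ → CETCState A
  | 0 => ⟨alg, []⟩
  | t + 1 => (cetcState m alg x t).step m (x t (cetcState m alg x t).play)

/-- The action that C-ETC plays at time `t`. -/
noncomputable def cetcAction {A : Type} (m : ℕ) (alg : OracleAlg A) (x : ℕ → A → ℝ) (t : ℕ) : A :=
  (cetcState m alg x t).play

/-! ### Stochastic rewards and regret -/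

/-- `X t a` is the random reward `f_t(a)` of action `a` at time `t < T`: on the feasible actions the
rewards are `[0,1]`-valued, independent over time and, for each action, identically distributed
with mean `f a`. -/
structure IsRewardModel {Ω A : Type*} [MeasurableSpace Ω] (μ : Measure Ω) (D : Set A) (T : ℕ)
    (X : ℕ → A → Ω → ℝ) (f : A → ℝ) : Prop where
  measurable : ∀ t < T, ∀ a ∈ D, Measurable (X t a)
  bounded : ∀ t < T, ∀ a ∈ D, ∀ᵐ ω ∂μ, X t a ω ∈ Set.Icc (0 : ℝ) 1
  indep : iIndepFun (fun (t : Fin T) (ω : Ω) (a : D) => X t a ω) μ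
  identDistrib : ∀ s < T, ∀ t < T, ∀ a ∈ D, IdentDistrib (X s a) (X t a) μ μ
  mean : ∀ t < T, ∀ a ∈ D, ∫ ω, X t a ω ∂μ = f a

/-- The cumulative reward `∑_{t < T} f_t(A_t)`. -/
noncomputable def cumulativeReward {Ω A : Type*} (T : ℕ) (X : ℕ → A → Ω → ℝ) (act : Ω → ℕ → A)
    (ω : Ω) : ℝ :=
  ∑ t ∈ Finset.range T, X t (act ω t) ω

/-- The expected cumulative `α`-regret, with `optVal` the optimal expected reward `f(OPT)`. -/
noncomputable def expectedRegret {Ω A : Type*} [MeasurableSpace Ω] (μ : Measure Ω) (α : ℝ) (T : ℕ)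
    (optVal : ℝ) (X : ℕ → A → Ω → ℝ) (act : Ω → ℕ → A) : ℝ :=
  α * T * optVal - ∫ ω, cumulativeReward T X act ω ∂μ

/-- The actions of C-ETC with the matroid greedy algorithm under the total size constraint, with
robustness parameter `δ = B + 1` and query bound `N = n k B`. -/
noncomputable def tsAction {Ω : Type*} {n k : ℕ} (B T : ℕ) (tie : TieRule n k)
    (X : ℕ → KVec n k → Ω → ℝ) (ω : Ω) (t : ℕ) : KVec n k :=
  cetcAction (cetcRepetitions ((B : ℝ) + 1) (n * k * B) T) (matroidGreedy (totalSize n B) tie)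
    (fun s a => X s a ω) t

end KSubBandit

/-! Offline part. Greedy is compared with a moving solution `o`, initially an optimum padded by
monotonicity to the greedy support size. In each round `o` gives up one element and receives the
greedy pair instead. By orthant submodularity and monotonicity this costs at most the greedy gain,
plus `2ε` when two `ε`-accurate values are compared (`exists_exchange`). After the last round `o` is
the greedy output, and telescoping gives `f a ≥ f opt / 2 - B ε`
(`matroidGreedy_totalSize_guarantee`). The bound is phrased on the tree of all answers
(`OracleAlg.Guarantee`), so it covers adaptive queries.

Stochastic part. The run splits into blocks of `m` plays, and the action of a block is determined by
earlier rewards (`measurableSet_descend_play_eq`). Independence over time then permits Hoeffding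
conditionally on that action, with no union over actions (`IsRewardModel.measureReal_blockMean_le`).
With `N = n k B` and `ε = √(log T / (2m))`, all `N` block means are `ε`-accurate up to probability
`2N/T`.

Balance. If `N m ≤ T`, the regret is at most `N m / 2` for exploration, `T B ε` for inexact answers
and `2N` for failure. If `N m > T`, then `T / 2 ≤ N m / 2` already suffices. The prescribed `m`
balances these costs, each of order `n^{1/3} k^{1/3} B T^{2/3} (log T)^{1/3}`
(`cetcRepetitions_pos_and_cost_le`). -/

namespace KSubBandit

/-! ### Running an oracle algorithm -/

namespace OracleAlg

variable {A : Type}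

/-- The pending query, or the output. -/
def play : OracleAlg A → A
  | .done a => a
  | .query a _ => a

/-- What remains after the pending query (if any) is answered by `ρ`. -/
def answer : OracleAlg A → ℝ → OracleAlg A
  | .done a, _ => .done a
  | .query _ next, ρ => next ρ

/-- What remains after the first `j` queries are answered by `r 0, …, r (j - 1)`. -/
def descend (alg : OracleAlg A) (r : ℕ → ℝ) : ℕ → OracleAlg A
  | 0 => alg
  | j + 1 => (descend alg r j).answer (r j)

/-- `descend` unfolds at the last answer, whereas the predicates on `OracleAlg` recurse from the
first query; this identity reconciles the two inductions. -/
theorem descend_succ' (alg : OracleAlg A) (r : ℕ → ℝ) (j : ℕ) :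
    alg.descend r (j + 1) = (alg.answer (r 0)).descend (fun i => r (i + 1)) j := by
  induction j with
  | zero => rfl
  | succ j ih => rw [descend, ih, descend]

theorem descend_congr (alg : OracleAlg A) {r r' : ℕ → ℝ} {j : ℕ} (h : ∀ i < j, r i = r' i) :
    alg.descend r j = alg.descend r' j := by
  induction j with
  | zero => rfl
  | succ j ih => rw [descend, descend, ih fun i hi => h i (by omega), h j (by omega)]

theorem descend_done (a : A) (r : ℕ → ℝ) (j : ℕ) : (done a).descend r j = done a := by
  induction j with
  | zero => rfl
  | succ j ih => rw [descend, ih, answer]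

/-- Every query and the output belong to `D`. -/
def PlaysIn (D : Set A) : OracleAlg A → Prop
  | .done a => a ∈ D
  | .query a next => a ∈ D ∧ ∀ ρ, (next ρ).PlaysIn D

theorem PlaysIn.play_mem {D : Set A} {alg : OracleAlg A} (h : alg.PlaysIn D) : alg.play ∈ D := by
  cases alg with
  | done a => exact h
  | query a next => exact h.1

theorem PlaysIn.answer {D : Set A} {alg : OracleAlg A} (h : alg.PlaysIn D) (ρ : ℝ) :
    (alg.answer ρ).PlaysIn D := by
  cases alg with
  | done a => exact h
  | query a next => exact h.2 ρ

theorem PlaysIn.descend {D : Set A} {alg : OracleAlg A} (h : alg.PlaysIn D) (r : ℕ → ℝ) (j : ℕ) :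
    (alg.descend r j).PlaysIn D := by
  induction j with
  | zero => exact h
  | succ j ih => exact ih.answer _

theorem QueriesAtMost.answer {alg : OracleAlg A} {N : ℕ} (h : alg.QueriesAtMost (N + 1)) (ρ : ℝ) :
    (alg.answer ρ).QueriesAtMost N := by
  cases alg with
  | done a => simp [OracleAlg.answer, QueriesAtMost]
  | query a next => exact h ρ

theorem QueriesAtMost.mono {alg : OracleAlg A} {N M : ℕ} (h : alg.QueriesAtMost N) (hNM : N ≤ M) :
    alg.QueriesAtMost M := by
  induction alg generalizing N M with
  | done a => simp [QueriesAtMost]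
  | query a next ih =>
    cases N with
    | zero => exact h.elim
    | succ N =>
      cases M with
      | zero => omega
      | succ M => exact fun ρ => ih ρ (h ρ) (by omega)

theorem QueriesAtMost.descend_eq_done {alg : OracleAlg A} {N : ℕ} (h : alg.QueriesAtMost N)
    (r : ℕ → ℝ) : ∃ a, alg.descend r N = done a := by
  induction N generalizing alg r with
  | zero =>
    cases alg with
    | done a => exact ⟨a, rfl⟩
    | query a next => exact h.elim
  | succ N ih => rw [descend_succ']; exact ih (h.answer _) _

theorem QueriesAtMost.descend_eq {alg : OracleAlg A} {N : ℕ} (h : alg.QueriesAtMost N)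
    (r : ℕ → ℝ) {j : ℕ} (hj : N ≤ j) : alg.descend r j = alg.descend r N := by
  obtain ⟨a, ha⟩ := h.descend_eq_done r
  induction j, hj using Nat.le_induction with
  | base => rfl
  | succ j _ ih => rw [descend, ih, ha, OracleAlg.answer]

/-- If all answers are `ε`-accurate values of `f`, the output satisfies `P`. -/
def Guarantee (f : A → ℝ) (ε : ℝ) (P : A → Prop) : OracleAlg A → Prop
  | .done a => P a
  | .query a next => ∀ ρ, |ρ - f a| ≤ ε → (next ρ).Guarantee f ε P

theorem Guarantee.imp {f : A → ℝ} {ε : ℝ} {P Q : A → Prop} {alg : OracleAlg A}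
    (h : alg.Guarantee f ε P) (hPQ : ∀ a, P a → Q a) : alg.Guarantee f ε Q := by
  induction alg with
  | done a => exact hPQ a h
  | query a next ih => exact fun ρ hρ => ih ρ (h ρ hρ)

/-- A run follows one branch of the query tree. Accuracy is demanded only at the queries on that
branch, so it does not matter that they depend on earlier answers. -/
theorem Guarantee.play_descend {f : A → ℝ} {ε : ℝ} {P : A → Prop} {alg : OracleAlg A} {N : ℕ}
    (h : alg.Guarantee f ε P) (hN : alg.QueriesAtMost N) {r : ℕ → ℝ}
    (hr : ∀ j < N, |r j - f (alg.descend r j).play| ≤ ε) : P (alg.descend r N).play := by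
  induction N generalizing alg r with
  | zero =>
    cases alg with
    | done a => exact h
    | query a next => exact hN.elim
  | succ N ih =>
    rw [descend_succ']
    refine ih ?_ (hN.answer _) fun j hj => ?_
    · cases alg with
      | done a => exact h
      | query a next => exact h _ (hr 0 (by omega))
    · rw [← descend_succ']
      exact hr (j + 1) (by omega)

end OracleAlg

/-! ### Batches of queries -/

section QueryValues

variable {A P : Type} [DecidableEq P] {act : P → A}

theorem queryValues_queriesAtMost {l : List P} {v : P → ℝ} {cont : (P → ℝ) → OracleAlg A} {N : ℕ}
    (h : ∀ v, (cont v).QueriesAtMost N) :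
    (queryValues act l v cont).QueriesAtMost (l.length + N) := by
  induction l generalizing v with
  | nil => simpa [queryValues] using h v
  | cons p l ih =>
    rw [List.length_cons, Nat.add_right_comm]
    exact fun ρ => ih

theorem queryValues_playsIn {D : Set A} {l : List P} {v : P → ℝ} {cont : (P → ℝ) → OracleAlg A}
    (hact : ∀ p ∈ l, act p ∈ D) (h : ∀ v, (cont v).PlaysIn D) :
    (queryValues act l v cont).PlaysIn D := by
  induction l generalizing v with
  | nil => exact h v
  | cons p l ih =>
    exact ⟨hact p (by simp), fun ρ => ih fun q hq => hact q (by simp [hq])⟩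

/-- The clause about unlisted entries carries the induction: an answer already recorded survives
unless its key occurs again, and then it is overwritten by another accurate one. -/
theorem queryValues_guarantee {f : A → ℝ} {ε : ℝ} {Q : A → Prop} {l : List P} {v : P → ℝ}
    {cont : (P → ℝ) → OracleAlg A}
    (h : ∀ v', (∀ p ∈ l, |v' p - f (act p)| ≤ ε) → (∀ p ∉ l, v' p = v p) →
      (cont v').Guarantee f ε Q) :
    (queryValues act l v cont).Guarantee f ε Q := by
  induction l generalizing v with
  | nil => exact h v (by simp) (by simp)
  | cons p l ih =>
    intro ρ hρ
    refine ih fun v' h1 h2 => h v' ?_ ?_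
    · intro q hq
      by_cases hql : q ∈ l
      · exact h1 q hql
      · obtain rfl : q = p := by simpa [hql] using hq
        rw [h2 q hql, Function.update_self]
        exact hρ
    · intro q hq
      simp only [List.mem_cons, not_or] at hq
      rw [h2 q hq.2, Function.update_of_ne hq.1]

end QueryValues

/-! ### The greedy algorithm -/

section Greedy

variable {n k : ℕ}

theorem supp_assign (x : KVec n k) (e : Fin n) (i : Fin k) :
    supp (assign x e i) = insert e (supp x) := by
  ext a
  by_cases h : a = e <;> simp [supp, assign, Function.update_apply, h]

theorem mem_supp {x : KVec n k} {e : Fin n} : e ∈ supp x ↔ x e ≠ none := by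
  simp [supp]

theorem mem_availablePairs {𝓕 : Finset (Finset (Fin n))} {s : KVec n k} {p : Fin n × Fin k} :
    p ∈ availablePairs 𝓕 s ↔ s p.1 = none ∧ insert p.1 (supp s) ∈ 𝓕 := by
  simp [availablePairs]

theorem mem_totalSize {B : ℕ} {S : Finset (Fin n)} : S ∈ totalSize n B ↔ S.card ≤ B := by
  simp [totalSize]

theorem mem_feasible_totalSize {B : ℕ} {x : KVec n k} :
    x ∈ feasible k (totalSize n B) ↔ (supp x).card ≤ B := by
  simp [feasible, mem_totalSize]

theorem greedyRounds_queriesAtMost (𝓕 : Finset (Finset (Fin n))) (tie : TieRule n k) (j : ℕ)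
    (s : KVec n k) : (greedyRounds 𝓕 tie j s).QueriesAtMost (n * k * j) := by
  induction j generalizing s with
  | zero => simp [greedyRounds, OracleAlg.QueriesAtMost]
  | succ j ih =>
    rw [greedyRounds]
    have hcard : (availablePairs 𝓕 s).toList.length ≤ n * k := by
      rw [Finset.length_toList]
      exact (Finset.card_le_univ _).trans (by simp)
    refine (queryValues_queriesAtMost (N := n * k * j) fun v => ?_).mono
      (by rw [Nat.mul_succ]; omega)
    split_ifs
    · exact ih _
    · simp [OracleAlg.QueriesAtMost]

theorem greedyRounds_playsIn (𝓕 : Finset (Finset (Fin n))) (tie : TieRule n k) (j : ℕ)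
    {s : KVec n k} (hs : s ∈ feasible k 𝓕) : (greedyRounds 𝓕 tie j s).PlaysIn (feasible k 𝓕) := by
  induction j generalizing s with
  | zero => exact hs
  | succ j ih =>
    have key : ∀ p ∈ availablePairs 𝓕 s, assign s p.1 p.2 ∈ feasible k 𝓕 := fun p hp => by
      simpa [feasible, supp_assign] using (mem_availablePairs.1 hp).2
    rw [greedyRounds]
    refine queryValues_playsIn (fun p hp => key p (by simpa using hp)) fun v => ?_
    split_ifs with h
    · exact ih (key _ (Finset.mem_filter.1 (tie s _ h).2).1)
    · exact hs

theorem matroidGreedy_totalSize_queriesAtMost (B : ℕ) (tie : TieRule n k) :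
    (matroidGreedy (totalSize n B) tie).QueriesAtMost (n * k * B) := by
  refine (greedyRounds_queriesAtMost _ tie _ _).mono (Nat.mul_le_mul_left _ ?_)
  rw [rank_totalSize]
  exact min_le_right _ _

theorem supp_none : supp (fun _ => none : KVec n k) = ∅ := by
  simp [supp]

theorem matroidGreedy_totalSize_playsIn (B : ℕ) (tie : TieRule n k) :
    (matroidGreedy (totalSize n B) tie).PlaysIn (feasible k (totalSize n B)) :=
  greedyRounds_playsIn _ tie _ (by simp [mem_feasible_totalSize, supp_none])

/-- Orthant submodularity: marginal gains decrease. -/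
theorem IsKSubmodular.marginal_le {f : KVec n k → ℝ} (hf : IsKSubmodular f) {x y : KVec n k}
    (hxy : ∀ e, x e ≠ none → y e = x e) {e : Fin n} (he : y e = none) (i : Fin k) :
    marginal f y e i ≤ marginal f x e i := by
  have hxe : x e = none := by
    by_contra h
    exact h ((hxy e h).symm.trans he)
  have h := hf (assign x e i) y
  -- The join is `y` plus the pair and the meet is `x`, so `k`-submodularity at this couple is
  -- exactly the claim.
  have hj : join (assign x e i) y = assign y e i := by
    funext a
    by_cases ha : a = e
    · subst ha; simp [join, assign, he]
    · by_cases hx : x a = none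
      · simp [join, assign, ha, hx]
      · simp [join, assign, ha, hx, hxy a hx]
  have hm : meet (assign x e i) y = x := by
    funext a
    by_cases ha : a = e
    · subst ha; simp [meet, assign, he, hxe]
    · by_cases hx : x a = none
      · simp [meet, assign, ha, hx]
      · simp [meet, assign, ha, hxy a hx]
  rw [hj, hm] at h
  unfold marginal
  linarith

/-- The exchange step: a solution `o` above `s` can be made to agree with `s` plus a nearly
greedy pair at a cost of at most the gain of that pair, up to the error. -/
theorem exists_exchange {f : KVec n k → ℝ} (hf : IsKSubmodular f) (hmono : IsKMonotone f)
    {s o : KVec n k} (hso : ∀ e, s e ≠ none → o e = s e) (hlt : (supp s).card < (supp o).card)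
    {e : Fin n} {i : Fin k} (he : s e = none) {η : ℝ}
    (hgreedy : ∀ a b, o a = some b → s a = none →
      marginal f s a b ≤ marginal f s e i + η) :
    ∃ o' : KVec n k, (∀ a, assign s e i a ≠ none → o' a = assign s e i a) ∧
      (supp o').card = (supp o).card ∧
      f o - f o' ≤ f (assign s e i) - f s + η := by
  have hsub : supp s ⊆ supp o := fun a ha => by
    rw [mem_supp] at ha ⊢
    rwa [hso a ha]
  -- The element to drop from `o`: it must be `e` itself if `o` uses `e`, possibly with another
  -- type; otherwise any element of `o` outside `s` serves.
  obtain ⟨a, hao, has, hae⟩ : ∃ a ∈ supp o, a ∉ supp s ∧ (e ∈ supp o → a = e) := by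
    by_cases heo : e ∈ supp o
    · exact ⟨e, heo, by simp [mem_supp, he], fun _ => rfl⟩
    · obtain ⟨a, ha⟩ := Finset.exists_mem_notMem_of_card_lt_card hlt
      exact ⟨a, ha.1, ha.2, fun h => absurd h heo⟩
  obtain ⟨b, hb⟩ := Option.ne_none_iff_exists'.1 (mem_supp.1 hao)
  have has' : s a = none := by simpa [mem_supp] using has
  set z : KVec n k := Function.update o a none with hz
  have hzs : ∀ c, s c ≠ none → z c = s c := fun c hc => by
    have : c ≠ a := by rintro rfl; exact hc has'
    rw [hz, Function.update_of_ne this, hso c hc]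
  have hza : z a = none := by simp [hz]
  have hze : z e = none := by
    by_cases hea : e = a
    · rw [hea, hza]
    · rw [hz, Function.update_of_ne hea]
      by_contra h
      exact hea (hae (mem_supp.2 h)).symm
  have ho : assign z a b = o := by
    simp [assign, hz, ← hb]
  refine ⟨assign z e i, fun c hc => ?_, ?_, ?_⟩
  · by_cases hce : c = e
    · subst hce; simp [assign]
    · simp only [assign, Function.update_of_ne hce] at hc ⊢
      exact hzs c hc
  · have h1 : e ∉ supp z := by simp [mem_supp, hze]
    have h2 : a ∉ supp z := by simp [mem_supp, hza]
    rw [← ho, supp_assign, supp_assign, Finset.card_insert_of_notMem h1,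
      Finset.card_insert_of_notMem h2]
  -- With `z` equal to `o` without `a`: dropping `a` loses at most its gain at the smaller `s`,
  -- which is at most the gain of `(e, i)` plus `η`; adding `(e, i)` to `z` loses nothing by
  -- monotonicity.
  · have h1 := hf.marginal_le hzs hza b
    have h2 := hmono z e i hze
    have h3 := hgreedy a b hb has'
    unfold marginal at h1 h2 h3
    rw [ho] at h1
    linarith

/-- Induction on the remaining rounds `j`, which equal the number of elements by which `o` exceeds
`s`. Each round replaces `o` by the exchanged solution; at `j = 0` the two coincide. -/
theorem greedyRounds_guarantee {f : KVec n k → ℝ} (hf : IsKSubmodular f) (hmono : IsKMonotone f)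
    (B : ℕ) (tie : TieRule n k) {ε : ℝ} (j : ℕ) {s o : KVec n k}
    (hso : ∀ e, s e ≠ none → o e = s e) (hcard : (supp o).card = (supp s).card + j)
    (hB : (supp o).card ≤ B) :
    (greedyRounds (totalSize n B) tie j s).Guarantee f ε
      fun a => f o - f a ≤ f a - f s + 2 * ε * j := by
  have hsub : supp s ⊆ supp o := fun a ha => by
    rw [mem_supp] at ha ⊢
    rwa [hso a ha]
  induction j generalizing s o with
  | zero =>
    have hs : supp s = supp o := Finset.eq_of_subset_of_card_le hsub (by omega)
    have : o = s := by
      funext e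
      by_cases he : s e = none
      · rw [he]
        by_contra h
        exact mem_supp.1 (hs ▸ mem_supp.2 h) he
      · exact hso e he
    subst this
    simp [greedyRounds, OracleAlg.Guarantee]
  | succ j ih =>
    rw [greedyRounds]
    refine queryValues_guarantee fun v hv _ => ?_
    simp only [Finset.mem_toList] at hv
    have havail : ∀ e i, s e = none → (e, i) ∈ availablePairs (totalSize n B) s := by
      intro e i he
      rw [mem_availablePairs, mem_totalSize]
      exact ⟨he, (Finset.card_insert_le _ _).trans (by omega)⟩
    have hne : (availablePairs (totalSize n B) s).Nonempty := by
      obtain ⟨a, hao, has⟩ := Finset.exists_mem_notMem_of_card_lt_card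
        (show (supp s).card < (supp o).card by omega)
      obtain ⟨b, hb⟩ := Option.ne_none_iff_exists'.1 (mem_supp.1 hao)
      exact ⟨(a, b), havail a b (by simpa [mem_supp] using has)⟩
    obtain ⟨p₀, hp₀, hmax⟩ := Finset.exists_max_image _ v hne
    split_ifs with hS
    swap
    · exact absurd ⟨p₀, Finset.mem_filter.2 ⟨hp₀, hmax⟩⟩ hS
    generalize tie s _ _ = p
    obtain ⟨⟨e, i⟩, hp⟩ := p
    obtain ⟨hpa, hpm⟩ := Finset.mem_filter.1 hp
    have he : s e = none := (mem_availablePairs.1 hpa).1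
    obtain ⟨o', h1, h2, h3⟩ := exists_exchange hf hmono hso (by omega) (i := i) he (η := 2 * ε) <| by
      intro a b _ ha
      have hab := havail a b ha
      have q1 := abs_le.1 (hv _ hab)
      have q2 := abs_le.1 (hv _ hpa)
      have q3 := hpm _ hab
      simp only [marginal] at q1 q2 ⊢
      linarith [q1.1, q2.2]
    have hes : e ∉ supp s := by simp [mem_supp, he]
    have hcs : (supp (assign s e i)).card = (supp s).card + 1 := by
      rw [supp_assign, Finset.card_insert_of_notMem hes]
    have := ih h1 (by omega) (by omega) (fun a ha => by
      rw [mem_supp] at ha ⊢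
      rwa [h1 a ha])
    have hP : ∀ a, f o' - f a ≤ f a - f (assign s e i) + 2 * ε * j →
        f o - f a ≤ f a - f s + 2 * ε * (j + 1 : ℕ) := by
      intro a ha
      push_cast
      linarith
    exact this.imp hP

/-- Pads an optimum to exactly as many elements as greedy has rounds. A new element needs some type,
whence `0 < k`. -/
theorem IsKMonotone.exists_extension {f : KVec n k → ℝ} (hmono : IsKMonotone f) (hk : 0 < k)
    (x : KVec n k) (c : ℕ) (h1 : (supp x).card ≤ c) (h2 : c ≤ n) :
    ∃ y, (supp y).card = c ∧ f x ≤ f y := by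
  induction c, h1 using Nat.le_induction with
  | base => exact ⟨x, rfl, le_rfl⟩
  | succ c _ ih =>
    obtain ⟨y, hy, hxy⟩ := ih (by omega)
    obtain ⟨e, he⟩ : ∃ e, e ∉ supp y := by
      by_contra! h
      have : supp y = Finset.univ := Finset.eq_univ_iff_forall.2 h
      rw [this, Finset.card_univ, Fintype.card_fin] at hy
      omega
    have hye : y e = none := by simpa [mem_supp] using he
    refine ⟨assign y e ⟨0, hk⟩, by rw [supp_assign, Finset.card_insert_of_notMem he, hy], ?_⟩
    have := hmono y e ⟨0, hk⟩ hye
    unfold marginal at this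
    linarith

/-- The greedy algorithm with `ε`-accurate values is a `1/2`-approximation up to `B ε`. -/
theorem matroidGreedy_totalSize_guarantee {f : KVec n k → ℝ} (hf : IsKSubmodular f)
    (hmono : IsKMonotone f) (hk : 0 < k) (B : ℕ) (tie : TieRule n k) {ε : ℝ} (hε : 0 ≤ ε)
    (h0 : 0 ≤ f fun _ => none) {opt : KVec n k} (hopt : opt ∈ feasible k (totalSize n B)) :
    (matroidGreedy (totalSize n B) tie).Guarantee f ε fun a => f opt / 2 - B * ε ≤ f a := by
  rw [mem_feasible_totalSize] at hopt
  obtain ⟨o, ho, hle⟩ := hmono.exists_extension hk opt (min n B)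
    (le_min ((Finset.card_le_univ _).trans (by simp)) hopt) (min_le_left _ _)
  have := greedyRounds_guarantee hf hmono B tie (ε := ε) (rank (totalSize n B))
    (s := fun _ => none) (o := o) (by simp) (by rw [rank_totalSize, ho, supp_none]; simp)
    (ho.le.trans (min_le_right _ _))
  refine this.imp fun a ha => ?_
  have hr : (rank (totalSize n B) : ℝ) ≤ B := by
    rw [rank_totalSize]
    exact_mod_cast min_le_right _ _
  nlinarith

end Greedy

/-! ### C-ETC plays in blocks of length `m` -/

section Blocks

variable {A : Type}

theorem CETCState.play_eq (st : CETCState A) : st.play = st.alg.play := by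
  obtain ⟨alg, l⟩ := st
  cases alg <;> rfl

/-- A pending query is played once before the count is tested, so `m = 0` behaves as `m = 1`; hence
`0 < m` may be assumed later. -/
theorem CETCState.step_max_one (m : ℕ) (st : CETCState A) (r : ℝ) :
    st.step (max m 1) r = st.step m r := by
  obtain ⟨alg, l⟩ := st
  cases alg with
  | done a => rfl
  | query a next =>
    have : l.length + 1 < max m 1 ↔ l.length + 1 < m := by omega
    simp only [CETCState.step, this]

theorem cetcAction_max_one (m : ℕ) (alg : OracleAlg A) (x : ℕ → A → ℝ) (t : ℕ) :
    cetcAction (max m 1) alg x t = cetcAction m alg x t := by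
  have : ∀ t, cetcState (max m 1) alg x t = cetcState m alg x t := fun t => by
    induction t with
    | zero => rfl
    | succ t ih => rw [cetcState, cetcState, ih, CETCState.step_max_one]
  rw [cetcAction, cetcAction, this]

/-- The empirical mean of the rewards of the `j`-th block of `m` plays. -/
noncomputable def blockMean (m : ℕ) (alg : OracleAlg A) (x : ℕ → A → ℝ) (j : ℕ) : ℝ :=
  (∑ i ∈ Finset.range m, x (j * m + i) (cetcState m alg x (j * m)).alg.play) / m

theorem cetcState_add_of_done {m : ℕ} {alg : OracleAlg A} {x : ℕ → A → ℝ} {t : ℕ} {a : A}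
    (h : cetcState m alg x t = ⟨.done a, []⟩) (i : ℕ) :
    cetcState m alg x (t + i) = ⟨.done a, []⟩ := by
  induction i with
  | zero => exact h
  | succ i ih => rw [← Nat.add_assoc, cetcState, ih]; rfl

theorem cetcState_add_of_query {m : ℕ} {alg : OracleAlg A} {x : ℕ → A → ℝ} {t : ℕ} {a : A}
    {next : ℝ → OracleAlg A} (h : cetcState m alg x t = ⟨.query a next, []⟩) {i : ℕ} (hi : i < m) :
    ∃ l : List ℝ, l.length = i ∧ l.sum = ∑ i' ∈ Finset.range i, x (t + i') a ∧
      cetcState m alg x (t + i) = ⟨.query a next, l⟩ := by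
  induction i with
  | zero => exact ⟨[], by simp, by simp, h⟩
  | succ i ih =>
    obtain ⟨l, hl, hs, hst⟩ := ih (by omega)
    refine ⟨x (t + i) a :: l, by simp [hl], ?_, ?_⟩
    · rw [List.sum_cons, hs, Finset.sum_range_succ, add_comm]
    · rw [← Nat.add_assoc, cetcState, hst]
      simp [CETCState.step, CETCState.play, hl, hi]

/-- Since a finished algorithm ignores answers, the commitment phase can be cut into blocks as well,
and one formula describes the state at every multiple of `m`. -/
theorem cetcState_mul {m : ℕ} (hm : 0 < m) (alg : OracleAlg A) (x : ℕ → A → ℝ) (j : ℕ) :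
    cetcState m alg x (j * m) = ⟨alg.descend (blockMean m alg x) j, []⟩ := by
  induction j with
  | zero => rw [Nat.zero_mul]; rfl
  | succ j ih =>
    rw [OracleAlg.descend, Nat.succ_mul]
    have hmean : blockMean m alg x j = (∑ i ∈ Finset.range m,
        x (j * m + i) (alg.descend (blockMean m alg x) j).play) / m := by
      conv_lhs => rw [blockMean, ih]
    generalize alg.descend (blockMean m alg x) j = g at ih hmean
    cases g with
    | done a => exact cetcState_add_of_done ih m
    | query a next =>
      -- After `m - 1` plays the query is still pending; the `m`-th play closes the block and hands
      -- over the mean.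
      obtain ⟨l, hl, hs, hst⟩ := cetcState_add_of_query ih (Nat.sub_lt hm one_pos)
      obtain ⟨m, rfl⟩ : ∃ m', m = m' + 1 := ⟨m - 1, by omega⟩
      simp only [Nat.add_sub_cancel] at hl hst hs
      rw [← Nat.add_assoc, cetcState, hst, OracleAlg.answer, hmean, Finset.sum_range_succ]
      simp [CETCState.step, CETCState.play, OracleAlg.play, hl, hs, add_comm]

theorem cetcState_alg_of_lt {m : ℕ} (hm : 0 < m) (alg : OracleAlg A) (x : ℕ → A → ℝ) (t : ℕ) :
    (cetcState m alg x t).alg = alg.descend (blockMean m alg x) (t / m) := by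
  have h := cetcState_mul hm alg x (t / m)
  have hi := Nat.mod_lt t hm
  have ht : t / m * m + t % m = t := Nat.div_add_mod' t m
  generalize alg.descend (blockMean m alg x) (t / m) = g at h
  cases g with
  | done a => rw [← ht, cetcState_add_of_done h]
  | query a next =>
    obtain ⟨l, -, -, hst⟩ := cetcState_add_of_query h hi
    rw [← ht, hst]

theorem cetcAction_eq {m : ℕ} (hm : 0 < m) (alg : OracleAlg A) (x : ℕ → A → ℝ) (t : ℕ) :
    cetcAction m alg x t = (alg.descend (blockMean m alg x) (t / m)).play := by
  rw [cetcAction, CETCState.play_eq, cetcState_alg_of_lt hm]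

theorem blockMean_eq {m : ℕ} (hm : 0 < m) (alg : OracleAlg A) (x : ℕ → A → ℝ) (j : ℕ) :
    blockMean m alg x j = (∑ i ∈ Finset.range m,
      x (j * m + i) (alg.descend (blockMean m alg x) j).play) / m := by
  conv_lhs => rw [blockMean, cetcState_mul hm]

theorem OracleAlg.PlaysIn.cetcAction_mem {D : Set A} {alg : OracleAlg A} (h : alg.PlaysIn D)
    (m : ℕ) (x : ℕ → A → ℝ) (t : ℕ) : cetcAction m alg x t ∈ D := by
  rw [← cetcAction_max_one, cetcAction_eq (by omega)]
  exact (h.descend _ _).play_mem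

end Blocks

/-! ### Measurability of the plays in the answers -/

section Measurability

variable {A : Type} {Y Z : Type*} [MeasurableSpace Y] [MeasurableSpace Z]

/-- The plays of the algorithms `F y` depend measurably on `y` and the answers. -/
def MeasurableFamily (F : Y → OracleAlg A) : Prop :=
  ∀ (j : ℕ) (a : A), MeasurableSet {p : Y × (ℕ → ℝ) | ((F p.1).descend p.2 j).play = a}

theorem MeasurableFamily.comp {F : Y → OracleAlg A} (hF : MeasurableFamily F) {g : Z → Y}
    (hg : Measurable g) : MeasurableFamily fun z => F (g z) := fun j a =>
  (hF j a).preimage (f := fun p : Z × (ℕ → ℝ) => (g p.1, p.2)) (by fun_prop)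

theorem measurableFamily_done (a : A) : MeasurableFamily fun _ : Y => OracleAlg.done a :=
  fun j b => by
    simp only [OracleAlg.descend_done]
    exact MeasurableSet.const _

theorem MeasurableFamily.query (a : A) {next : Y × ℝ → OracleAlg A} (h : MeasurableFamily next) :
    MeasurableFamily fun y => OracleAlg.query a fun ρ => next (y, ρ) := by
  intro j b
  cases j with
  | zero =>
    simp only [OracleAlg.descend, OracleAlg.play]
    exact MeasurableSet.const _
  | succ j =>
    simp only [OracleAlg.descend_succ', OracleAlg.answer]
    exact (h j b).preimage
      (f := fun p : Y × (ℕ → ℝ) => ((p.1, p.2 0), fun i => p.2 (i + 1))) (by fun_prop)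

theorem MeasurableFamily.of_countable [Countable Y] [MeasurableSingletonClass Y]
    {F : Y → OracleAlg A} (h : ∀ y, MeasurableFamily fun _ : Unit => F y) :
    MeasurableFamily F := by
  intro j a
  have : {p : Y × (ℕ → ℝ) | ((F p.1).descend p.2 j).play = a} =
      ⋃ y, {y} ×ˢ {r | ((F y).descend r j).play = a} := by
    ext ⟨y, r⟩
    simp
  rw [this]
  refine MeasurableSet.iUnion fun y => (measurableSet_singleton y).prod ?_
  exact (h y j a).preimage (f := fun r : ℕ → ℝ => ((), r)) (by fun_prop)

theorem measurableFamily_queryValues {P : Type} [DecidableEq P] (act : P → A) (l : List P)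
    {cont : (P → ℝ) → OracleAlg A} (h : MeasurableFamily cont) :
    MeasurableFamily fun v => queryValues act l v cont := by
  induction l with
  | nil => exact h
  | cons p l ih =>
    exact MeasurableFamily.query (act p)
      (ih.comp (g := fun q : (P → ℝ) × ℝ => Function.update q.1 p q.2) measurable_update')

/-- The continuation of a round depends on the answers only through the set `S v` of maximizers.
That set ranges over a finite type, so an arbitrary tie rule is harmless. -/
theorem measurableFamily_greedyRounds {n k : ℕ} (𝓕 : Finset (Finset (Fin n))) (tie : TieRule n k)
    (j : ℕ) (s : KVec n k) : MeasurableFamily fun _ : Unit => greedyRounds 𝓕 tie j s := by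
  induction j generalizing s with
  | zero => exact measurableFamily_done s
  | succ j ih =>
    let S : (Fin n × Fin k → ℝ) → Finset (Fin n × Fin k) := fun v =>
      (availablePairs 𝓕 s).filter fun p => ∀ q ∈ availablePairs 𝓕 s, v q ≤ v p
    let G : Finset (Fin n × Fin k) → OracleAlg (KVec n k) := fun U =>
      if h : U.Nonempty then greedyRounds 𝓕 tie j (assign s (tie s _ h).1.1 (tie s _ h).1.2)
      else .done s
    let _ : MeasurableSpace (Finset (Fin n × Fin k)) := ⊤
    have hS : Measurable S := by
      refine measurable_to_countable' fun U => ?_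
      have : S ⁻¹' {U} = ⋂ p, {v | p ∈ S v ↔ p ∈ U} := by
        ext v
        simp [Finset.ext_iff]
      rw [this]
      refine MeasurableSet.iInter fun p => ?_
      have hp : MeasurableSet {v | p ∈ S v} := by
        have : {v | p ∈ S v} = {v | p ∈ availablePairs 𝓕 s} ∩
            ⋂ q, ⋂ (_ : q ∈ availablePairs 𝓕 s), {v | v q ≤ v p} := by
          ext v
          simp [S]
        rw [this]
        exact (MeasurableSet.const _).inter <| MeasurableSet.iInter fun q =>
          MeasurableSet.iInter fun _ =>
            measurableSet_le (measurable_pi_apply q) (measurable_pi_apply p)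
      by_cases hU : p ∈ U
      · simpa [hU] using hp
      · simp only [hU, iff_false]
        exact hp.compl
    have hG : MeasurableFamily G := MeasurableFamily.of_countable fun U => by
      by_cases h : U.Nonempty
      · simpa only [G, dif_pos h] using ih _
      · simpa only [G, dif_neg h] using measurableFamily_done s
    have := measurableFamily_queryValues (fun p : Fin n × Fin k => assign s p.1 p.2)
      (availablePairs 𝓕 s).toList (hG.comp hS)
    exact this.comp (g := fun _ : Unit => fun _ => (0 : ℝ)) measurable_const

end Measurability

/-! ### Rewards of adaptively chosen actions -/

section Rewards

variable {Ω : Type*} {A : Type} {D : Set A} {T : ℕ} {X : ℕ → A → Ω → ℝ}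

/-- The `σ`-algebra generated by the rewards of the feasible actions at the times in `S`. -/
@[reducible] def rewardSigma (D : Set A) (X : ℕ → A → Ω → ℝ) (S : Set (Fin T)) : MeasurableSpace Ω :=
  ⨆ s ∈ S, MeasurableSpace.comap (fun (ω : Ω) (a : D) => X s a ω) inferInstance

theorem rewardSigma_mono {S S' : Set (Fin T)} (h : S ⊆ S') :
    rewardSigma D X S ≤ rewardSigma D X S' :=
  biSup_mono fun _ hs => h hs

theorem measurable_rewardSigma {S : Set (Fin T)} {s : Fin T} (hs : s ∈ S) {a : A} (ha : a ∈ D) :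
    Measurable[rewardSigma D X S] (X s a) := by
  have h1 : Measurable[MeasurableSpace.comap (fun (ω : Ω) (a : D) => X s a ω) inferInstance]
      (fun (ω : Ω) (a : D) => X s a ω) := comap_measurable _
  have h2 := (measurable_pi_apply (⟨a, ha⟩ : D)).comp h1
  exact h2.mono (le_biSup (fun s : Fin T => MeasurableSpace.comap
    (fun (ω : Ω) (a : D) => X s a ω) inferInstance) hs) le_rfl

/-- The times before `t`. -/
def timesBefore (T t : ℕ) : Set (Fin T) := {s | (s : ℕ) < t}

theorem rewardSigma_timesBefore_mono {t t' : ℕ} (h : t ≤ t') :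
    rewardSigma D X (timesBefore T t) ≤ rewardSigma D X (timesBefore T t') :=
  rewardSigma_mono fun _ hs => lt_of_lt_of_le hs h

section BlockMeasurability

variable [Finite A] {m : ℕ} {alg : OracleAlg A}

/-- Strong induction on the block: its action is a measurable function of the earlier block means,
and these involve only rewards observed before time `j * m`. -/
theorem measurableSet_descend_play_eq (halg : alg.PlaysIn D)
    (hmeas : MeasurableFamily fun _ : Unit => alg) (hm : 0 < m) (j : ℕ) (hj : j * m ≤ T) (a : A) :
    MeasurableSet[rewardSigma D X (timesBefore T (j * m))]
      {ω | (alg.descend (blockMean m alg fun s b => X s b ω) j).play = a} := by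
  induction j using Nat.strong_induction_on generalizing a with
  | _ j ih =>
    have hblock : ∀ i < j, Measurable[rewardSigma D X (timesBefore T (j * m))]
        fun ω => blockMean m alg (fun s b => X s b ω) i := by
      intro i hi
      have him : i * m + m ≤ j * m := by
        rw [← Nat.succ_mul]
        exact Nat.mul_le_mul_right m hi
      have := Fintype.ofFinite A
      classical
      let b : Ω → A := fun ω => (alg.descend (blockMean m alg fun s b => X s b ω) i).play
      have hb : ∀ ω, b ω ∈ D := fun ω => (halg.descend _ _).play_mem
      -- Splitting over the finitely many possible actions replaces a reward at a random action by
      -- rewards at fixed ones.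
      have hsum : (fun ω => blockMean m alg (fun s b => X s b ω) i) = fun ω =>
          ∑ c : D, if b ω = c then (∑ l ∈ Finset.range m, X (i * m + l) c ω) / m else 0 := by
        funext ω
        rw [blockMean_eq hm, Finset.sum_eq_single (⟨b ω, hb ω⟩ : D)]
        · rw [if_pos rfl]
        · rintro ⟨c, hc⟩ - hne
          rw [if_neg]
          rintro rfl
          exact hne rfl
        · simp
      rw [hsum]
      refine Finset.measurable_sum _ fun c _ => Measurable.ite ?_ ?_ measurable_const
      · exact rewardSigma_timesBefore_mono (by omega) _ (ih i hi (by omega) c)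
      · refine Measurable.div_const (Finset.measurable_sum _ fun l hl => ?_) _
        have hl' := Finset.mem_range.1 hl
        exact measurable_rewardSigma (s := (⟨i * m + l, by omega⟩ : Fin T))
          (show i * m + l < j * m by omega) c.2
    -- Later answers are set to `0` so that the whole sequence is measurable with respect to the
    -- past; the first `j` steps do not see them.
    let r : Ω → ℕ → ℝ := fun ω i => if i < j then blockMean m alg (fun s b => X s b ω) i else 0
    let _ := rewardSigma D X (timesBefore T (j * m))
    have hr : Measurable r := by
      refine measurable_pi_iff.2 fun i => ?_
      by_cases hi : i < j
      · simpa [r, hi] using hblock i hi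
      · simp [r, hi]
    have hset : {ω | (alg.descend (blockMean m alg fun s b => X s b ω) j).play = a} =
        (fun ω => ((), r ω)) ⁻¹' {p : Unit × (ℕ → ℝ) | (alg.descend p.2 j).play = a} := by
      ext ω
      have : alg.descend (blockMean m alg fun s b => X s b ω) j = alg.descend (r ω) j :=
        OracleAlg.descend_congr _ fun i hi => by simp [r, hi]
      simp [this]
    rw [hset]
    exact (measurable_const.prodMk hr) (hmeas j a)

end BlockMeasurability

/-! ### Independence of past and future, and concentration -/

variable [MeasurableSpace Ω] {μ : Measure Ω} {f : A → ℝ}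

theorem IsRewardModel.rewardSigma_le (h : IsRewardModel μ D T X f) (S : Set (Fin T)) :
    rewardSigma D X S ≤ ‹MeasurableSpace Ω› :=
  iSup₂_le fun s _ => (measurable_pi_iff.2 fun a : D => h.measurable s s.2 a a.2).comap_le

theorem IsRewardModel.indep_past (h : IsRewardModel μ D T X f) (t : ℕ) :
    Indep (rewardSigma D X (timesBefore T t)) (rewardSigma D X (timesBefore T t)ᶜ) μ :=
  indep_iSup_of_disjoint
    (fun s : Fin T => (measurable_pi_iff.2 fun a : D => h.measurable s s.2 a a.2).comap_le)
    h.indep disjoint_compl_right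

theorem IsRewardModel.integrable [IsProbabilityMeasure μ] (h : IsRewardModel μ D T X f) {t : ℕ} (ht : t < T) {a : A}
    (ha : a ∈ D) : Integrable (X t a) μ :=
  Integrable.of_mem_Icc 0 1 (h.measurable t ht a ha).aemeasurable (h.bounded t ht a ha)

theorem IsRewardModel.mean_mem_Icc [IsProbabilityMeasure μ] (h : IsRewardModel μ D T X f) (hT : 0 < T) {a : A}
    (ha : a ∈ D) : f a ∈ Set.Icc (0 : ℝ) 1 := by
  rw [← h.mean 0 hT a ha]
  have hb := h.bounded 0 hT a ha
  constructor
  · exact integral_nonneg_of_ae (hb.mono fun ω hω => hω.1)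
  · calc ∫ ω, X 0 a ω ∂μ ≤ ∫ _, (1 : ℝ) ∂μ :=
          integral_mono_ae (h.integrable hT ha) (integrable_const _) (hb.mono fun ω hω => hω.2)
      _ = 1 := by simp

section Choice

variable [Finite A] {b : Ω → A}

theorem integrable_choice (hb : ∀ ω, b ω ∈ D) (hbm : ∀ a, MeasurableSet {ω | b ω = a})
    {g : A → Ω → ℝ} (hg : ∀ a ∈ D, Integrable (g a) μ) : Integrable (fun ω => g (b ω) ω) μ := by
  have huniv : (⋃ a : D, {ω | b ω = a}) = Set.univ := by
    ext ω
    simpa using hb ω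
  rw [← integrableOn_univ, ← huniv, integrableOn_finite_iUnion]
  intro a
  refine (integrableOn_congr_fun (fun ω hω => ?_) (hbm a)).2 (hg a a.2).integrableOn
  simp only [Set.mem_ofPred_eq] at hω
  simp only [hω]

theorem integral_choice [Fintype D] (hb : ∀ ω, b ω ∈ D)
    (hbm : ∀ a, MeasurableSet {ω | b ω = a})
    {g : A → Ω → ℝ} (hg : ∀ a ∈ D, Integrable (g a) μ) :
    ∫ ω, g (b ω) ω ∂μ = ∑ a : D, ∫ ω in {ω | b ω = a}, g a ω ∂μ := by
  have huniv : (⋃ a : D, {ω | b ω = a}) = Set.univ := by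
    ext ω
    simpa using hb ω
  rw [← setIntegral_univ, ← huniv, integral_iUnion_fintype (fun a : D => hbm a) ?_ ?_]
  · refine Finset.sum_congr rfl fun a _ => setIntegral_congr_fun (hbm a) fun ω hω => ?_
    simp only [Set.mem_ofPred_eq] at hω
    simp only [hω]
  · intro a a' haa'
    refine Set.disjoint_left.2 fun ω h1 h2 => haa' (Subtype.ext ?_)
    exact h1.symm.trans h2
  · exact fun a => (integrable_choice hb hbm hg).integrableOn

/-- The expected reward of an action chosen from the past is its expected mean. -/
theorem IsRewardModel.integral_choice_eq [IsProbabilityMeasure μ] (h : IsRewardModel μ D T X f) {t : ℕ} (ht : t < T)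
    (hb : ∀ ω, b ω ∈ D)
    (hbm : ∀ a, MeasurableSet[rewardSigma D X (timesBefore T t)] {ω | b ω = a}) :
    ∫ ω, X t (b ω) ω ∂μ = ∫ ω, f (b ω) ∂μ := by
  have := Fintype.ofFinite D
  have hbm' : ∀ a, MeasurableSet {ω | b ω = a} := fun a => h.rewardSigma_le _ _ (hbm a)
  rw [integral_choice (g := X t) hb hbm' fun a ha => h.integrable ht ha,
    integral_choice (g := fun a _ => f a) hb hbm' fun a _ => integrable_const _]
  refine Finset.sum_congr rfl fun a _ => ?_
  -- The event that `a` is chosen belongs to the past and the reward of the fixed action `a` at time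
  -- `t` does not, so each term of the sum factorizes.
  have hindep : Indep (rewardSigma D X (timesBefore T t))
      (MeasurableSpace.comap (X t a) inferInstance) μ := by
    refine indep_of_indep_of_le_right (h.indep_past t) ?_
    exact (measurable_rewardSigma (S := (timesBefore T t)ᶜ) (s := ⟨t, ht⟩)
      (by simp [timesBefore]) a.2).comap_le
  rw [hindep.setIntegral_eq_mul (f := fun x => x) (h.rewardSigma_le _)
    (h.measurable t ht a a.2).aemeasurable (hbm a) aestronglyMeasurable_id, h.mean t ht a a.2]
  simp

end Choice

/-- Hoeffding's inequality for a block of plays of a fixed action. -/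
theorem IsRewardModel.measureReal_block_le [IsProbabilityMeasure μ] (h : IsRewardModel μ D T X f) {t m : ℕ} (hm : 0 < m)
    (ht : t + m ≤ T) {a : A} (ha : a ∈ D) {ε : ℝ} (hε : 0 ≤ ε) :
    μ.real {ω | ε < |(∑ i ∈ Finset.range m, X (t + i) a ω) / m - f a|} ≤
      2 * Real.exp (-(2 * m * ε ^ 2)) := by
  let g : Fin m → Fin T := fun i => ⟨t + i, by omega⟩
  have hg : Function.Injective g := fun i i' hi => by
    have := congrArg Fin.val hi
    simp only [g] at this
    omega
  have hind : iIndepFun (fun (i : Fin m) ω => X (t + i) a ω - f a) μ :=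
    (h.indep.precomp hg).comp (fun _ (y : D → ℝ) => y ⟨a, ha⟩ - f a) fun _ => by fun_prop
  have hind' : iIndepFun (fun (i : Fin m) => -fun ω => X (t + i) a ω - f a) μ :=
    hind.comp (fun _ y => -y) fun _ => measurable_neg
  have hsub : ∀ i : Fin m, HasSubgaussianMGF (fun ω => X (t + i) a ω - f a)
      ((‖(1 : ℝ) - 0‖₊ / 2) ^ 2) μ := fun i => by
    have := hasSubgaussianMGF_of_mem_Icc (h.measurable (t + i) (by omega) a ha).aemeasurable
      (h.bounded (t + i) (by omega) a ha)
    rwa [h.mean (t + i) (by omega) a ha] at this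
  have hm' : (0 : ℝ) < m := by exact_mod_cast hm
  -- Each centred reward has variance proxy `1/4`, so the sum has `m/4`, and the deviation `m ε`
  -- yields the exponent `-2 m ε ^ 2`.
  have hexp : Real.exp (-(m * ε) ^ 2 / (2 * ∑ i ∈ (Finset.univ : Finset (Fin m)),
      ((fun _ => (‖(1 : ℝ) - 0‖₊ / 2) ^ 2 : Fin m → NNReal) i : NNReal))) =
      Real.exp (-(2 * m * ε ^ 2)) := by
    congr 1
    simp
    field_simp
  have h1 := HasSubgaussianMGF.measure_sum_ge_le_of_iIndepFun hind (s := Finset.univ)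
    (fun i _ => hsub i) (ε := m * ε) (by positivity)
  have h2 := HasSubgaussianMGF.measure_sum_ge_le_of_iIndepFun hind' (s := Finset.univ)
    (fun i _ => (hsub i).neg) (ε := m * ε) (by positivity)
  rw [hexp] at h1 h2
  have hsum : ∀ ω, (∑ i ∈ Finset.range m, X (t + i) a ω) / m - f a =
      (∑ i : Fin m, (X (t + i) a ω - f a)) / m := fun ω => by
    rw [Finset.sum_sub_distrib, Fin.sum_univ_eq_sum_range (fun i => X (t + i) a ω)]
    simp
    field_simp
  calc μ.real {ω | ε < |(∑ i ∈ Finset.range m, X (t + i) a ω) / m - f a|}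
      ≤ μ.real ({ω | m * ε ≤ ∑ i : Fin m, (X (t + i) a ω - f a)} ∪
          {ω | m * ε ≤ ∑ i : Fin m, (-fun ω => X (t + i) a ω - f a) ω}) := by
        refine measureReal_mono fun ω hω => ?_
        simp only [Set.mem_ofPred_eq, hsum, lt_abs, ← neg_div, lt_div_iff₀ hm'] at hω
        simp only [Set.mem_union, Set.mem_ofPred_eq, Pi.neg_apply, Finset.sum_neg_distrib]
        rcases hω with hω | hω
        · left; linarith
        · right; linarith
    _ ≤ _ := (measureReal_union_le _ _).trans (by linarith)

end Rewards

/-! ### The expected reward of C-ETC -/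

section CETC

variable {Ω : Type*} {A : Type} [Finite A] {D : Set A} {T m : ℕ} {X : ℕ → A → Ω → ℝ}
  {alg : OracleAlg A}

theorem measurableSet_cetcAction_eq (halg : alg.PlaysIn D)
    (hmeas : MeasurableFamily fun _ : Unit => alg) {t : ℕ} (ht : t ≤ T) (a : A) :
    MeasurableSet[rewardSigma D X (timesBefore T t)]
      {ω | cetcAction m alg (fun s b => X s b ω) t = a} := by
  have hm : 0 < max m 1 := by omega
  have hle : t / max m 1 * max m 1 ≤ t := Nat.div_mul_le_self _ _
  simp only [← cetcAction_max_one m, cetcAction_eq hm]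
  exact rewardSigma_timesBefore_mono hle _
    (measurableSet_descend_play_eq halg hmeas hm _ (hle.trans ht) a)

variable [MeasurableSpace Ω] {μ : Measure Ω} [IsProbabilityMeasure μ] {f : A → ℝ}

theorem IsRewardModel.integrable_play (h : IsRewardModel μ D T X f) (halg : alg.PlaysIn D)
    (hmeas : MeasurableFamily fun _ : Unit => alg) {t : ℕ} (ht : t < T) :
    Integrable (fun ω => X t (cetcAction m alg (fun s b => X s b ω) t) ω) μ :=
  integrable_choice (g := X t) (D := D) (fun _ => halg.cetcAction_mem m _ t)
    (fun a => h.rewardSigma_le _ _ (measurableSet_cetcAction_eq halg hmeas ht.le a))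
    fun _ ha => h.integrable ht ha

theorem IsRewardModel.integrable_cumulativeReward (h : IsRewardModel μ D T X f)
    (halg : alg.PlaysIn D) (hmeas : MeasurableFamily fun _ : Unit => alg) :
    Integrable (cumulativeReward T X fun ω => cetcAction m alg fun s b => X s b ω) μ :=
  integrable_finsetSum _ fun _ ht => h.integrable_play halg hmeas (Finset.mem_range.1 ht)

theorem IsRewardModel.integral_cumulativeReward (h : IsRewardModel μ D T X f)
    (halg : alg.PlaysIn D) (hmeas : MeasurableFamily fun _ : Unit => alg) :
    ∫ ω, cumulativeReward T X (fun ω => cetcAction m alg fun s b => X s b ω) ω ∂μ =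
      ∑ t ∈ Finset.range T, ∫ ω, f (cetcAction m alg (fun s b => X s b ω) t) ∂μ := by
  unfold cumulativeReward
  rw [integral_finsetSum _ fun t ht => h.integrable_play halg hmeas (Finset.mem_range.1 ht)]
  refine Finset.sum_congr rfl fun t ht => ?_
  have ht' := Finset.mem_range.1 ht
  exact h.integral_choice_eq ht' (fun _ => halg.cetcAction_mem m _ t)
    (measurableSet_cetcAction_eq halg hmeas ht'.le)

/-- The empirical mean of a block is close to the mean of the action played in it, although that
action is random. -/
theorem IsRewardModel.measureReal_blockMean_le (h : IsRewardModel μ D T X f)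
    (halg : alg.PlaysIn D) (hmeas : MeasurableFamily fun _ : Unit => alg) (hm : 0 < m) {j : ℕ}
    (hj : j * m + m ≤ T) {ε : ℝ} (hε : 0 ≤ ε) :
    μ.real {ω | ε < |blockMean m alg (fun s b => X s b ω) j -
      f (alg.descend (blockMean m alg fun s b => X s b ω) j).play|} ≤
      2 * Real.exp (-(2 * m * ε ^ 2)) := by
  have := Fintype.ofFinite D
  let b : Ω → A := fun ω => (alg.descend (blockMean m alg fun s b => X s b ω) j).play
  have hb : ∀ ω, b ω ∈ D := fun ω => (halg.descend _ _).play_mem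
  have hbm : ∀ a, MeasurableSet[rewardSigma D X (timesBefore T (j * m))] {ω | b ω = a} :=
    measurableSet_descend_play_eq halg hmeas hm j (by omega)
  let bad : A → Set Ω := fun a =>
    {ω | ε < |(∑ i ∈ Finset.range m, X (j * m + i) a ω) / m - f a|}
  have hbad : ∀ a ∈ D, MeasurableSet[rewardSigma D X (timesBefore T (j * m))ᶜ] (bad a) := by
    intro a ha
    let _ := rewardSigma D X (timesBefore T (j * m))ᶜ
    have hsum : Measurable fun ω => ∑ i ∈ Finset.range m, X (j * m + i) a ω := by
      refine Finset.measurable_sum _ fun i hi => ?_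
      have hi' := Finset.mem_range.1 hi
      exact measurable_rewardSigma (s := (⟨j * m + i, by omega⟩ : Fin T))
        (by simp [timesBefore]) ha
    exact measurableSet_lt measurable_const ((hsum.div_const _).sub_const _).abs
  -- On `{b = a}`, a past event, the deviation is that of the fixed action `a` over later times. The
  -- product bounds share one Hoeffding factor and the probabilities of the choices sum to `1`.
  have hsub : {ω | ε < |blockMean m alg (fun s b => X s b ω) j - f (b ω)|} ⊆
      ⋃ a : D, {ω | b ω = a} ∩ bad a := by
    intro ω hω
    refine Set.mem_iUnion.2 ⟨⟨b ω, hb ω⟩, rfl, ?_⟩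
    have hω' : ε < |blockMean m alg (fun s b => X s b ω) j - f (b ω)| := hω
    rwa [blockMean_eq hm] at hω'
  have hone : ∑ a : D, μ.real {ω | b ω = a} = 1 := by
    have := integral_choice (μ := μ) (g := fun _ _ => (1 : ℝ)) hb
      (fun a => h.rewardSigma_le _ _ (hbm a)) fun _ _ => integrable_const _
    simpa using this.symm
  calc _ ≤ μ.real (⋃ a : D, {ω | b ω = a} ∩ bad a) := measureReal_mono hsub (measure_ne_top _ _)
    _ ≤ ∑ a : D, μ.real ({ω | b ω = a} ∩ bad a) := measureReal_iUnion_fintype_le _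
    _ ≤ ∑ a : D, μ.real {ω | b ω = a} * (2 * Real.exp (-(2 * m * ε ^ 2))) := by
        refine Finset.sum_le_sum fun a _ => ?_
        have := (Indep_iff _ _ μ).1 (h.indep_past (j * m)) _ _ (hbm a) (hbad a a.2)
        rw [measureReal_def, this, ENNReal.toReal_mul]
        exact mul_le_mul_of_nonneg_left (h.measureReal_block_le hm hj a.2 hε) measureReal_nonneg
    _ = 2 * Real.exp (-(2 * m * ε ^ 2)) := by rw [← Finset.sum_mul, hone, one_mul]

/-- The expected reward of C-ETC when the exploration ends before the horizon. -/
theorem IsRewardModel.le_integral_cumulativeReward (h : IsRewardModel μ D T X f)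
    (halg : alg.PlaysIn D) (hmeas : MeasurableFamily fun _ : Unit => alg) (hm : 0 < m) {N : ℕ}
    (hN : alg.QueriesAtMost N) (hNT : N * m ≤ T) {ε c : ℝ} (hε : 0 ≤ ε) (hc : c ≤ 1)
    (hguar : alg.Guarantee f ε fun a => c ≤ f a) :
    ((T : ℝ) - N * m) * (c - N * (2 * Real.exp (-(2 * m * ε ^ 2)))) ≤
      ∫ ω, cumulativeReward T X (fun ω => cetcAction m alg fun s b => X s b ω) ω ∂μ := by
  rw [h.integral_cumulativeReward halg hmeas]
  have hcommit : ∀ t < T, N * m ≤ t → c - N * (2 * Real.exp (-(2 * m * ε ^ 2))) ≤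
      ∫ ω, f (cetcAction m alg (fun s b => X s b ω) t) ∂μ := by
    intro t htT ht
    let b : Ω → A := fun ω => cetcAction m alg (fun s b => X s b ω) t
    have hb : ∀ ω, b ω ∈ D := fun ω => halg.cetcAction_mem m _ t
    have hbm : ∀ a, MeasurableSet {ω | b ω = a} := fun a =>
      h.rewardSigma_le _ _ (measurableSet_cetcAction_eq halg hmeas htT.le a)
    let E : Set Ω := {ω | f (b ω) < c}
    have hE : MeasurableSet E := by
      have : E = ⋃ a ∈ {a | f a < c}, {ω | b ω = a} := by
        ext ω
        simp [E]
      rw [this]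
      exact MeasurableSet.biUnion (Set.to_countable _) fun a _ => hbm a
    have hmeasE : μ.real E ≤ N * (2 * Real.exp (-(2 * m * ε ^ 2))) := by
      -- If all `N` block means are accurate, the guarantee applies to the output, which is the
      -- action played at every time `t ≥ N * m`.
      have hsub : E ⊆ ⋃ j ∈ Finset.range N, {ω | ε < |blockMean m alg (fun s b => X s b ω) j -
          f (alg.descend (blockMean m alg fun s b => X s b ω) j).play|} := by
        intro ω hω
        by_contra hgood
        simp only [Finset.mem_range, Set.mem_iUnion, Set.mem_ofPred_eq, not_exists, not_lt]
          at hgood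
        have := hguar.play_descend hN hgood
        have hω' : f (cetcAction m alg (fun s b => X s b ω) t) < c := hω
        rw [cetcAction_eq hm, hN.descend_eq _ ((Nat.le_div_iff_mul_le hm).2 ht)] at hω'
        linarith
      calc μ.real E ≤ _ := measureReal_mono hsub (measure_ne_top _ _)
        _ ≤ ∑ j ∈ Finset.range N, _ := measureReal_biUnion_finset_le _ _
        _ ≤ ∑ j ∈ Finset.range N, 2 * Real.exp (-(2 * m * ε ^ 2)) := by
            refine Finset.sum_le_sum fun j hj =>
              h.measureReal_blockMean_le halg hmeas hm ?_ hε
            rw [← Nat.succ_mul]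
            exact (Nat.mul_le_mul_right m (Finset.mem_range.1 hj)).trans hNT
        _ = _ := by simp
    have hint : ∫ ω, (c - E.indicator (fun _ => (1 : ℝ)) ω) ∂μ = c - μ.real E := by
      rw [integral_sub (integrable_const _) ((integrable_const _).indicator hE),
        integral_indicator_const _ hE]
      simp
    calc _ ≤ c - μ.real E := by linarith
      _ = ∫ ω, (c - E.indicator (fun _ => (1 : ℝ)) ω) ∂μ := hint.symm
      -- On `E` the bound `0 ≤ f` suffices, because `c ≤ 1`.
      _ ≤ ∫ ω, f (b ω) ∂μ := by
        refine integral_mono ((integrable_const _).sub ((integrable_const _).indicator hE))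
          (integrable_choice (g := fun a _ => f a) hb hbm fun _ _ => integrable_const _)
          fun ω => ?_
        by_cases hω : ω ∈ E
        · have := (h.mean_mem_Icc (by omega) (hb ω)).1
          simp only [Set.indicator_of_mem hω]
          linarith
        · simp only [Set.indicator_of_notMem hω, sub_zero]
          exact not_lt.1 hω
  have hexplore : ∀ t < T, 0 ≤ ∫ ω, f (cetcAction m alg (fun s b => X s b ω) t) ∂μ :=
    fun t ht => integral_nonneg fun ω =>
      (h.mean_mem_Icc (by omega) (halg.cetcAction_mem m _ t)).1
  rw [← Finset.sum_range_add_sum_Ico _ hNT]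
  refine le_add_of_nonneg_of_le (Finset.sum_nonneg fun t ht => hexplore t ?_) ?_
  · exact (Finset.mem_range.1 ht).trans_le hNT
  · refine le_trans (le_of_eq ?_) (Finset.card_nsmul_le_sum _ _ _ fun t ht =>
      hcommit t (Finset.mem_Ico.1 ht).2 (Finset.mem_Ico.1 ht).1)
    rw [Nat.card_Ico, nsmul_eq_mul, Nat.cast_sub hNT]
    push_cast
    rfl

end CETC

/-! ### The choice of the number of repetitions -/

/-- Here `p, q, b, a, l, d` stand for the cube roots of `n, k, B, T, log T, B + 1`, so `N = (p q
b)^3`. The `+ 1` comes from the ceiling and is absorbed by `p q ≤ a`. The term with `m` contributes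
`2u` and the failure term `4u`. -/
theorem exploration_cost_le {p q b a l d m : ℝ} (hp : 0 < p) (hq : 0 < q) (hb : 0 < b) (ha : 0 < a)
    (hl : 1 / 2 ≤ l) (hbd : b ≤ d) (hdb : d ≤ 2 * b) (hpq : p * q ≤ a)
    (hm : m ≤ d ^ 2 * a ^ 2 * l / (2 * (p * q * b) ^ 2) + 1) :
    (p * q * b) ^ 3 * m / 2 + 2 * (p * q * b) ^ 3 ≤ 6 * (p * q * b ^ 3 * a ^ 2 * l) := by
  set u := p * q * b ^ 3 * a ^ 2 * l with hu
  have hd : 0 < d := hb.trans_le hbd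
  have h1 : (p * q * b) ^ 3 * (d ^ 2 * a ^ 2 * l / (2 * (p * q * b) ^ 2)) ≤ 2 * u := by
    calc (p * q * b) ^ 3 * (d ^ 2 * a ^ 2 * l / (2 * (p * q * b) ^ 2))
        = p * q * b * a ^ 2 * l / 2 * d ^ 2 := by field_simp
      _ ≤ p * q * b * a ^ 2 * l / 2 * (2 * b) ^ 2 := by gcongr
      _ = 2 * u := by rw [hu]; ring
  have h2 : (p * q * b) ^ 3 ≤ 2 * u := by
    calc (p * q * b) ^ 3 = p * q * b ^ 3 * (p * q) ^ 2 * 1 := by ring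
      _ ≤ p * q * b ^ 3 * a ^ 2 * (2 * l) := by gcongr; linarith
      _ = 2 * u := by rw [hu]; ring
  have h3 : (p * q * b) ^ 3 * m ≤
      (p * q * b) ^ 3 * (d ^ 2 * a ^ 2 * l / (2 * (p * q * b) ^ 2) + 1) := by gcongr
  linarith

/-- As `b ≤ d`, the factor `δ = B + 1` outweighs the `B` inside `N`, so `m` is at least `a^2 l / (2
(p q)^2)` and the accuracy is at most `l p q / a`. -/
theorem commitment_cost_le {p q b a l d m : ℝ} (hp : 0 < p) (hq : 0 < q) (hb : 0 < b) (ha : 0 < a)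
    (hl : 0 < l) (hbd : b ≤ d) (hm : d ^ 2 * a ^ 2 * l / (2 * (p * q * b) ^ 2) ≤ m) :
    a ^ 3 * (b ^ 3 * √(l ^ 3 / (2 * m))) ≤ p * q * b ^ 3 * a ^ 2 * l := by
  have h1 : a ^ 2 * l / (2 * (p * q) ^ 2) ≤ m := by
    calc a ^ 2 * l / (2 * (p * q) ^ 2) = b ^ 2 * a ^ 2 * l / (2 * (p * q * b) ^ 2) := by field_simp
      _ ≤ d ^ 2 * a ^ 2 * l / (2 * (p * q * b) ^ 2) := by gcongr
      _ ≤ m := hm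
  have hm0 : 0 < m := lt_of_lt_of_le (by positivity) h1
  have h2 : √(l ^ 3 / (2 * m)) ≤ l * (p * q) / a := by
    rw [Real.sqrt_le_left (by positivity), div_le_iff₀ (by positivity)]
    rw [div_le_iff₀ (by positivity)] at h1
    calc l ^ 3 = l ^ 2 / a ^ 2 * (a ^ 2 * l) := by field_simp
      _ ≤ l ^ 2 / a ^ 2 * (m * (2 * (p * q) ^ 2)) := by gcongr
      _ = (l * (p * q) / a) ^ 2 * (2 * m) := by field_simp
  calc a ^ 3 * (b ^ 3 * √(l ^ 3 / (2 * m))) ≤ a ^ 3 * (b ^ 3 * (l * (p * q) / a)) := by gcongr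
    _ = p * q * b ^ 3 * a ^ 2 * l := by field_simp

theorem rpow_one_third_pow_three {x : ℝ} (hx : 0 ≤ x) : (x ^ (1 / 3 : ℝ)) ^ 3 = x := by
  rw [← Real.rpow_natCast, ← Real.rpow_mul hx]
  norm_num

theorem rpow_two_thirds {x : ℝ} (hx : 0 ≤ x) : x ^ (2 / 3 : ℝ) = (x ^ (1 / 3 : ℝ)) ^ 2 := by
  rw [← Real.rpow_natCast, ← Real.rpow_mul hx]
  norm_num

theorem cetcRepetitions_pos_and_cost_le {n k B T : ℕ} (hn : 0 < n) (hk : 0 < k) (hB : 0 < B)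
    (hT : 2 ≤ T) (hnk : n * k ≤ T) :
    0 < cetcRepetitions ((B : ℝ) + 1) (n * k * B) T ∧
    ((n * k * B : ℕ) : ℝ) * cetcRepetitions ((B : ℝ) + 1) (n * k * B) T / 2 +
      2 * ((n * k * B : ℕ) : ℝ) +
      T * (B * √(Real.log T / (2 * cetcRepetitions ((B : ℝ) + 1) (n * k * B) T))) ≤
      7 * (n : ℝ) ^ (1 / 3 : ℝ) * (k : ℝ) ^ (1 / 3 : ℝ) * B * (T : ℝ) ^ (2 / 3 : ℝ) *
        Real.log T ^ (1 / 3 : ℝ) := by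
  -- The value `1/8` is chosen for its cube root `1/2`, the lower bound required of `l`.
  have hlog : 1 / 8 ≤ Real.log T := by
    have h1 : Real.log 2 ≤ Real.log T := Real.log_le_log (by norm_num) (by exact_mod_cast hT)
    linarith [Real.log_two_gt_d9]
  set m := cetcRepetitions ((B : ℝ) + 1) (n * k * B) T with hm
  unfold cetcRepetitions at hm
  have hN : (((n * k * B : ℕ) : ℝ)) ^ (1 / 3 : ℝ) =
      (n : ℝ) ^ (1 / 3 : ℝ) * (k : ℝ) ^ (1 / 3 : ℝ) * (B : ℝ) ^ (1 / 3 : ℝ) := by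
    push_cast
    rw [Real.mul_rpow (by positivity) (by positivity),
      Real.mul_rpow (by positivity) (by positivity)]
  have hN3 := rpow_one_third_pow_three (x := ((n * k * B : ℕ) : ℝ)) (by positivity)
  rw [rpow_two_thirds (x := (B : ℝ) + 1) (by positivity),
    rpow_two_thirds (x := (T : ℝ)) (by positivity),
    rpow_two_thirds (x := ((n * k * B : ℕ) : ℝ)) (by positivity), hN] at hm
  rw [hN] at hN3
  rw [rpow_two_thirds (x := (T : ℝ)) (by positivity)]
  have hn3 := rpow_one_third_pow_three (x := (n : ℝ)) (by positivity)
  have hk3 := rpow_one_third_pow_three (x := (k : ℝ)) (by positivity)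
  have hB3 := rpow_one_third_pow_three (x := (B : ℝ)) (by positivity)
  have hT3 := rpow_one_third_pow_three (x := (T : ℝ)) (by positivity)
  have hd3 := rpow_one_third_pow_three (x := (B : ℝ) + 1) (by positivity)
  have hl3 := rpow_one_third_pow_three (x := Real.log T) (by linarith)
  have hp : 0 < (n : ℝ) ^ (1 / 3 : ℝ) := by positivity
  have hq : 0 < (k : ℝ) ^ (1 / 3 : ℝ) := by positivity
  have hb : 0 < (B : ℝ) ^ (1 / 3 : ℝ) := by positivity
  have ha : 0 < (T : ℝ) ^ (1 / 3 : ℝ) := by positivity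
  have hd : 0 < ((B : ℝ) + 1) ^ (1 / 3 : ℝ) := by positivity
  have hl : 0 < Real.log T ^ (1 / 3 : ℝ) := Real.rpow_pos_of_pos (by linarith) _
  have hB1 : (1 : ℝ) ≤ B := by exact_mod_cast hB
  have hnkT : (n : ℝ) * k ≤ T := by exact_mod_cast hnk
  generalize (n : ℝ) ^ (1 / 3 : ℝ) = p at *
  generalize (k : ℝ) ^ (1 / 3 : ℝ) = q at *
  generalize (B : ℝ) ^ (1 / 3 : ℝ) = b at *
  generalize (T : ℝ) ^ (1 / 3 : ℝ) = a at *
  generalize ((B : ℝ) + 1) ^ (1 / 3 : ℝ) = d at *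
  generalize Real.log T ^ (1 / 3 : ℝ) = l at *
  have hl2 : 1 / 2 ≤ l := by
    rw [← pow_le_pow_iff_left₀ (by norm_num) hl.le (by norm_num : 3 ≠ 0)]
    linarith
  have hbd : b ≤ d := by
    rw [← pow_le_pow_iff_left₀ hb.le hd.le (by norm_num : 3 ≠ 0)]
    linarith
  have hdb : d ≤ 2 * b := by
    rw [← pow_le_pow_iff_left₀ hd.le (by positivity) (by norm_num : 3 ≠ 0), mul_pow]
    linarith
  have hpq : p * q ≤ a := by
    rw [← pow_le_pow_iff_left₀ (by positivity) ha.le (by norm_num : 3 ≠ 0), mul_pow, hn3, hk3, hT3]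
    exact hnkT
  have hx : 0 < d ^ 2 * a ^ 2 * l / (2 * (p * q * b) ^ 2) := by positivity
  have hm1 : d ^ 2 * a ^ 2 * l / (2 * (p * q * b) ^ 2) ≤ m := hm ▸ Nat.le_ceil _
  have hm2 : (m : ℝ) ≤ d ^ 2 * a ^ 2 * l / (2 * (p * q * b) ^ 2) + 1 :=
    hm ▸ (Nat.ceil_lt_add_one hx.le).le
  refine ⟨by exact_mod_cast hx.trans_le hm1, ?_⟩
  have h1 := exploration_cost_le hp hq hb ha hl2 hbd hdb hpq hm2
  have h2 := commitment_cost_le hp hq hb ha hl hbd hm1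
  rw [hN3] at h1
  rw [hT3, hl3] at h2
  rw [hB3] at h1 h2
  linarith

/-! ### The regret bound -/

/-- In the degenerate case the claimed bound is `0`; there the empty vector is the only feasible
action, so every play is optimal. -/
theorem eq_none_of_mem_feasible {n k B : ℕ} (h : n * k * B = 0) {x : KVec n k}
    (hx : x ∈ feasible k (totalSize n B)) : x = fun _ => none := by
  funext e
  by_contra he
  obtain ⟨i, -⟩ := Option.ne_none_iff_exists'.1 he
  have hpos : 0 < (supp x).card := Finset.card_pos.2 ⟨e, mem_supp.2 he⟩
  rw [mem_feasible_totalSize] at hx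
  have h1 : 0 < n * k * B := Nat.mul_pos (Nat.mul_pos e.pos i.pos) (by omega)
  omega

/-- The second entry of the maximum exceeds `1` even at `B = 1`, where it is `3√2/4`. This excludes
`T = 1`, for which `log T`, and with it the regret bound, would vanish. -/
theorem two_le_horizon {n k B T : ℕ} (hn : 0 < n) (hk : 0 < k) (hB : 0 < B)
    (hT : (n : ℝ) * k * max 1 (3 * √2 * B / (2 * ((B : ℝ) + 1))) ≤ T) : 2 ≤ T := by
  have hB1 : (1 : ℝ) ≤ B := by exact_mod_cast hB
  have h2 : (1.4 : ℝ) ≤ √2 := Real.le_sqrt_of_sq_le (by norm_num)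
  have h3 : 1 < 3 * √2 * B / (2 * ((B : ℝ) + 1)) := by
    rw [lt_div_iff₀ (by positivity)]
    nlinarith
  have hnk : (1 : ℝ) ≤ n * k := by exact_mod_cast Nat.mul_pos hn hk
  have h4 := lt_of_lt_of_le h3 (le_max_right (1 : ℝ) _)
  have : (1 : ℝ) < T := lt_of_lt_of_le (by nlinarith) hT
  exact_mod_cast this

theorem tsAction_mem_feasible {Ω : Type*} {n k : ℕ} (B T : ℕ) (tie : TieRule n k) (X : ℕ → KVec n k → Ω → ℝ) (ω : Ω)
    (t : ℕ) : tsAction B T tie X ω t ∈ feasible k (totalSize n B) :=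
  (matroidGreedy_totalSize_playsIn B tie).cetcAction_mem _ _ _

section Regret

variable {Ω : Type*} [MeasurableSpace Ω] {μ : Measure Ω} [IsProbabilityMeasure μ] {n k B T : ℕ}
  {X : ℕ → KVec n k → Ω → ℝ} {f : KVec n k → ℝ} {opt : KVec n k}

theorem measurableFamily_matroidGreedy (𝓕 : Finset (Finset (Fin n))) (tie : TieRule n k) :
    MeasurableFamily fun _ : Unit => matroidGreedy 𝓕 tie :=
  measurableFamily_greedyRounds _ _ _ _

theorem integral_tsReward (tie : TieRule n k)
    (h : IsRewardModel μ (feasible k (totalSize n B)) T X f) :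
    ∫ ω, cumulativeReward T X (tsAction B T tie X) ω ∂μ =
      ∑ t ∈ Finset.range T, ∫ ω, f (tsAction B T tie X ω t) ∂μ :=
  h.integral_cumulativeReward (matroidGreedy_totalSize_playsIn B tie)
    (measurableFamily_matroidGreedy _ tie)

theorem expectedRegret_nonpos_of_eq_zero (tie : TieRule n k)
    (h : IsRewardModel μ (feasible k (totalSize n B)) T X f)
    (hopt : opt ∈ feasible k (totalSize n B)) (hz : n * k * B = 0) :
    expectedRegret μ (1 / 2) T (f opt) X (tsAction B T tie X) ≤ 0 := by
  have hact : ∀ ω t, tsAction B T tie X ω t = opt := fun ω t => by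
    rw [eq_none_of_mem_feasible hz (tsAction_mem_feasible B T tie X ω t),
      eq_none_of_mem_feasible hz hopt]
  rw [expectedRegret, integral_tsReward tie h]
  simp only [hact]
  rcases Nat.eq_zero_or_pos T with rfl | hT
  · simp
  · have := (h.mean_mem_Icc hT hopt).1
    simp only [integral_const, probReal_univ, smul_eq_mul, one_mul, Finset.sum_const,
      Finset.card_range, nsmul_eq_mul]
    nlinarith [mul_nonneg (Nat.cast_nonneg (α := ℝ) T) this]

theorem expectedRegret_le_cost (tie : TieRule n k) (hf : IsKSubmodular f) (hmono : IsKMonotone f)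
    (h : IsRewardModel μ (feasible k (totalSize n B)) T X f)
    (hopt : opt ∈ feasible k (totalSize n B)) (hk : 0 < k) (hT : 2 ≤ T) {m : ℕ}
    (hmdef : cetcRepetitions ((B : ℝ) + 1) (n * k * B) T = m) (hm : 0 < m) :
    expectedRegret μ (1 / 2) T (f opt) X (tsAction B T tie X) ≤
      ((n * k * B : ℕ) : ℝ) * m / 2 + 2 * ((n * k * B : ℕ) : ℝ) +
        T * (B * √(Real.log T / (2 * m))) := by
  have hT0 : 0 < T := by omega
  have hTR : (0 : ℝ) < T := by exact_mod_cast hT0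
  have hmR : (0 : ℝ) < m := by exact_mod_cast hm
  obtain ⟨ho0, ho1⟩ := h.mean_mem_Icc hT0 hopt
  have hlog : 0 ≤ Real.log T := Real.log_natCast_nonneg T
  set ε := √(Real.log T / (2 * m)) with hε
  have hε0 : 0 ≤ ε := Real.sqrt_nonneg _
  have hBε : 0 ≤ (B : ℝ) * ε := by positivity
  rw [expectedRegret]
  rcases le_total (n * k * B * m) T with hNT | hNT
  -- This is why `ε` has its form: each block fails with probability at most `2 / T`, so the
  -- failures of `N` blocks cost at most `2 N` over the horizon.
  · have hexp : Real.exp (-(2 * m * ε ^ 2)) = (T : ℝ)⁻¹ := by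
      rw [hε, Real.sq_sqrt (by positivity), mul_div_cancel₀ _ (by positivity), Real.exp_neg,
        Real.exp_log hTR]
    have h0 := (h.mean_mem_Icc (a := fun _ => none) hT0
      (by simp [mem_feasible_totalSize, supp_none])).1
    have key := h.le_integral_cumulativeReward (matroidGreedy_totalSize_playsIn B tie)
      (measurableFamily_matroidGreedy _ tie) hm (matroidGreedy_totalSize_queriesAtMost B tie) hNT
      hε0 (by linarith) (matroidGreedy_totalSize_guarantee hf hmono hk B tie hε0 h0 hopt)
    rw [hexp] at key
    have hint : ∫ ω, cumulativeReward T X (tsAction B T tie X) ω ∂μ =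
        ∫ ω, cumulativeReward T X (fun ω => cetcAction m (matroidGreedy (totalSize n B) tie)
          fun s b => X s b ω) ω ∂μ := by
      rw [← hmdef]
      rfl
    rw [hint]
    refine (sub_le_sub_left key _).trans ?_
    have hNTR : ((n * k * B : ℕ) : ℝ) * m ≤ T := by exact_mod_cast hNT
    have hN0 : (0 : ℝ) ≤ ((n * k * B : ℕ) : ℝ) := by positivity
    generalize ((n * k * B : ℕ) : ℝ) = N at *
    have hinv : (T : ℝ) * (N * (2 * (T : ℝ)⁻¹)) = 2 * N := by field_simp
    have h1 : 0 ≤ N * m * (B * ε + N * (2 * (T : ℝ)⁻¹)) := by positivity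
    have h2 : N * m * f opt ≤ N * m := mul_le_of_le_one_right (by positivity) ho1
    linarith
  -- Exploration may exhaust the horizon; then `T / 2`, the largest possible regret, is below the
  -- exploration term.
  · have hnonneg : 0 ≤ ∫ ω, cumulativeReward T X (tsAction B T tie X) ω ∂μ := by
      rw [integral_tsReward tie h]
      exact Finset.sum_nonneg fun t _ => integral_nonneg fun ω =>
        (h.mean_mem_Icc hT0 (tsAction_mem_feasible B T tie X ω t)).1
    have hNTR : (T : ℝ) ≤ ((n * k * B : ℕ) : ℝ) * m := by exact_mod_cast hNT
    have h1 : (T : ℝ) * f opt ≤ T := mul_le_of_le_one_right hTR.le ho1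
    have h2 : 0 ≤ (T : ℝ) * (B * ε) := by positivity
    have h3 : (0 : ℝ) ≤ ((n * k * B : ℕ) : ℝ) := by positivity
    linarith

end Regret

end KSubBandit

theorem mainTheorem11 :
    (∀ (n k B : ℕ) (tie : KSubBandit.TieRule n k),
      (KSubBandit.matroidGreedy (KSubBandit.totalSize n B) tie).QueriesAtMost (n * k * B)) ∧
    ∃ C : ℝ, 0 < C ∧
      ∀ (n k B T : ℕ) (tie : KSubBandit.TieRule n k) (f : KSubBandit.KVec n k → ℝ)
        (Ω : Type*) [MeasurableSpace Ω] (μ : MeasureTheory.Measure Ω)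
        [MeasureTheory.IsProbabilityMeasure μ]
        (X : ℕ → KSubBandit.KVec n k → Ω → ℝ) (opt : KSubBandit.KVec n k),
        KSubBandit.IsKSubmodular f →
        KSubBandit.IsKMonotone f →
        KSubBandit.IsRewardModel μ (KSubBandit.feasible k (KSubBandit.totalSize n B)) T X f →
        opt ∈ KSubBandit.feasible k (KSubBandit.totalSize n B) →
        IsMaxOn f (KSubBandit.feasible k (KSubBandit.totalSize n B)) opt →
        (n : ℝ) * k * max 1 (3 * √2 * B / (2 * ((B : ℝ) + 1))) ≤ T →
        (∀ t < T, ∀ ω, KSubBandit.tsAction B T tie X ω t ∈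
          KSubBandit.feasible k (KSubBandit.totalSize n B)) ∧
        MeasureTheory.Integrable
          (KSubBandit.cumulativeReward T X (KSubBandit.tsAction B T tie X)) μ ∧
        KSubBandit.expectedRegret μ (1 / 2) T (f opt) X (KSubBandit.tsAction B T tie X) ≤
          C * (n : ℝ) ^ (1 / 3 : ℝ) * (k : ℝ) ^ (1 / 3 : ℝ) * B * (T : ℝ) ^ (2 / 3 : ℝ) *
            Real.log T ^ (1 / 3 : ℝ) := by
  -- The constant `7` is `6` from exploration and failure plus `1` from commitment.
  refine ⟨fun n k B tie => KSubBandit.matroidGreedy_totalSize_queriesAtMost B tie, 7, by norm_num, ?_⟩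
  intro n k B T tie f Ω _ μ _ X opt hf hmono h hopt _ hT
  refine ⟨fun t _ ω => KSubBandit.tsAction_mem_feasible B T tie X ω t,
    h.integrable_cumulativeReward (KSubBandit.matroidGreedy_totalSize_playsIn B tie)
      (KSubBandit.measurableFamily_matroidGreedy _ tie), ?_⟩
  rcases Nat.eq_zero_or_pos (n * k * B) with hz | hpos
  · have hlog : 0 ≤ Real.log T := Real.log_natCast_nonneg T
    exact (KSubBandit.expectedRegret_nonpos_of_eq_zero tie h hopt hz).trans (by positivity)
  · have hB : 0 < B := Nat.pos_of_mul_pos_left hpos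
    have hnk : 0 < n * k := Nat.pos_of_mul_pos_right hpos
    have hk : 0 < k := Nat.pos_of_mul_pos_left hnk
    have hn : 0 < n := Nat.pos_of_mul_pos_right hnk
    have hT2 := KSubBandit.two_le_horizon hn hk hB hT
    have hnkT : n * k ≤ T := by
      have : (n : ℝ) * k ≤ T :=
        (le_mul_of_one_le_right (by positivity) (le_max_left _ _)).trans hT
      exact_mod_cast this
    obtain ⟨hm, hcost⟩ := KSubBandit.cetcRepetitions_pos_and_cost_le hn hk hB hT2 hnkT
    exact (KSubBandit.expectedRegret_le_cost tie hf hmono h hopt hk hT2 rfl hm).trans hcost
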